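/- **Setting.** Let $G=(V,E,w)$ be a finite connected graph with positive edge weights, shortest-path distance $d$, and diameter $D$, in which any two distinct nodes are at distance at least $1$. Write $N_r(v)=\{x: d(v,x)\le r\}$. The doubling dimension of $G$ is the smallest $\delta$ such that every ball $N_r(v)$, $r\ge 0$, is covered by at most $2^\delta$ balls of radius $r/2$. An $(r,\sigma,I)$-partition of $V$ is a partition into clusters of diameter (measured in $G$) at most $r\sigma$ such that every $N_r(v)$ meets at most $I$ clusters. A partition hierarchy with parameters $\sigma,I$ consists, with $\rho=4\sigma$ and $h=\lceil\log_\rho D\rceil$ ($h=0$ if $D=0$), of a $(\min(D,\rho^l),\sigma,I)$-partition $\mathcal P_l$ for each level $l=0,\dots,h$, where $\mathcal P_h=\{V\}$, together with an arbitrary leader node in each cluster; the partitions need not be nested. A shared object is initially at a node $v'$, and $\mathcal T$ is a finite set of transactions, at most one per node, all of which need the object. Moving the object by one unit of distance costs $\alpha$, moving a transaction by one unit costs $\beta$, where $0<\beta<\alpha$. In a schedule the object follows a walk in $G$ from $v'$, and each transaction follows a walk from its node to some node visited by the object, where it is executed. The cost of a schedule is $\alpha$ times the length of the object's walk plus $\beta$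 times the total length of the transactions' walks; $C^*$ is the optimal cost. **Algorithm GlobalAware_SingleObj.** Let $\gamma=\lceil\alpha/\beta\rceil$. For $l=0,\dots,h$ and each cluster $X\in\mathcal P_l$: if at least $2\gamma$ transactions located in $X$ have no dedicated super-leader yet, then the leader of $X$ becomes the dedicated super-leader of all of these. Let $\widehat T_l$ be the set of transactions that got their dedicated super-leader at level $l$, and $\widehat L_l$ the set of these super-leaders. Let $R=\{l\in\{0,\dots,h\}: |\widehat T_l|\ge 8I\alpha/\beta\}$ and $S_f=\bigcup_{l\in R}\widehat L_l$. Each transaction in $\bigcup_{l\in R}\widehat T_l$ moves along a shortest path to its dedicated super-leader; every other transaction moves along a shortest path to $v'$. The object traverses a given closed tour of $S_f\cup\{v'\}$ from $v'$ (an ordering of these nodes, with consecutive nodes joined by shortest paths, returning to $v'$), executing the transactions found at each node. Let $C$ be the total cost, $Tour(S_f)$ the length of this tour, and $Tour^*(S_f)$ the minimum length of such a tour. The ratio $Tour(S_f)/Tour^*(S_f)$ is read as $1$ if $Tour^*(S_f)=0$ (in which case $S_f\subseteq\{v'\}$). **Theorem.** Let $\delta$ be a real number. 1. There are $\sigma$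 and $I$, depending only on $\delta$, such that every graph $G$ as above of doubling dimension at most $\delta$ has a partition hierarchy with parameters $\sigma,I$. 2. For all $\sigma$ and $I$ there is a constant $K$, depending only on $\delta,\sigma,I$, such that for every graph $G$ as above of doubling dimension at most $\delta$, every partition hierarchy of $G$ with parameters $\sigma,I$, all $v',\mathcal T,\alpha,\beta$ as above, and every tour used by the algorithm, $$C\ \le\ K\cdot C^*\cdot\frac{Tour(S_f)}{Tour^*(S_f)}\cdot\max\{1,\log_2 D\}.$$ In particular, for graphs of constant doubling dimension with $D\ge2$, $C=O\bigl(C^*\cdot\frac{Tour(S_f)}{Tour^*(S_f)}\cdot\log D\bigr)$. -/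

import Mathlib

universe u

noncomputable section

namespace DualFlow

/-- A finite connected network with positive edge weights. -/
structure WeightedGraph (V : Type u) where
  graph : SimpleGraph V
  weight : Sym2 V → ℝ
  weight_pos : ∀ e ∈ graph.edgeSet, 0 < weight e
  connected : graph.Connected

/-- `t` lists every node of `S` other than the starting point `s` exactly once, so that
`s :: t` is a TSP tour of `S ∪ {s}`. -/
def IsTour {V : Type u} [DecidableEq V] (s : V) (S : Finset V) (t : List V) : Prop :=
  t.Nodup ∧ t.toFinset = S.erase s

namespace WeightedGraph

variable {V : Type u} (G : WeightedGraph V)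

/-- The length of a walk: the sum of the weights of the edges it traverses. -/
def walkLength {a b : V} (p : G.graph.Walk a b) : ℝ := (p.edges.map G.weight).sum

/-- The shortest-path distance. -/
def dist (a b : V) : ℝ := ⨅ p : G.graph.Walk a b, G.walkLength p

/-- The diameter `D` of the network. -/
def diam : ℝ := ⨆ p : V × V, G.dist p.1 p.2

/-- The `r`-neighborhood of `v`, that is, the ball of radius `r` around `v`. -/
def ball (v : V) (r : ℝ) : Set V := {x | G.dist v x ≤ r}

/-- The smallest `δ` such that every ball of radius `r` is covered by at most `2 ^ δ` balls
of radius `r / 2`. -/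
def doublingDim : ℝ :=
  sInf {δ : ℝ | ∀ (v : V) (r : ℝ), 0 ≤ r → ∃ c : Finset V,
    (c.card : ℝ) ≤ (2 : ℝ) ^ δ ∧ G.ball v r ⊆ ⋃ x ∈ c, G.ball x (r / 2)}

/-- The total distance along a list of nodes, consecutive nodes being joined by
shortest paths. -/
def listLength : List V → ℝ
  | [] => 0
  | [_] => 0
  | a :: b :: l => G.dist a b + listLength (b :: l)

/-- The length of the closed tour that starts at `s`, visits the nodes of `t` in order and
returns to `s`. -/
def tourLength (s : V) (t : List V) : ℝ := G.listLength (s :: (t ++ [s]))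

variable [DecidableEq V]

/-- `Tour*(S)`: the length of an optimal TSP tour of `S ∪ {s}`. -/
def optTour (s : V) (S : Finset V) : ℝ := ⨅ t : {t : List V // IsTour s S t}, G.tourLength s t

/-- The approximation ratio `Tour(S) / Tour*(S)` of the tour `t`. If the optimal tour has
length zero, that is, if there is no node to visit except the starting point, then every tour
is optimal and the ratio is `1`. -/
def tourRatio (s : V) (S : Finset V) (t : List V) : ℝ :=
  if G.optTour s S = 0 then 1 else G.tourLength s t / G.optTour s S

variable [Fintype V]

/-- An `(r, σ, I)`-partition: every cluster has diameter at most `r * σ`, and every ball of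
radius `r` meets at most `I` clusters. -/
def IsSparsePartition (r σ : ℝ) (I : ℕ) (P : Finpartition (Finset.univ : Finset V)) : Prop :=
  (∀ X ∈ P.parts, ∀ a ∈ X, ∀ b ∈ X, G.dist a b ≤ r * σ) ∧
  ∀ v : V, {X : Finset V | X ∈ P.parts ∧ ((X : Set V) ∩ G.ball v r).Nonempty}.ncard ≤ I

/-- The index `h = ⌈log_ρ D⌉` of the top level of a hierarchy. -/
def topLevel (ρ : ℝ) : ℕ := ⌈Real.logb ρ G.diam⌉₊

end WeightedGraph

/-- A partition hierarchy with parameters `σ`, `I` and `ρ = 4 * σ`: for each level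
`l = 0, …, h` a `(min D (ρ ^ l), σ, I)`-partition (partitions at different levels need not be
nested), with an arbitrary leader in each cluster; the top level `h` is a single cluster.
Values at levels above `h` are irrelevant. -/
structure PartitionHierarchy {V : Type u} [Fintype V] [DecidableEq V] (G : WeightedGraph V)
    (σ : ℝ) (I : ℕ) where
  partition : ℕ → Finpartition (Finset.univ : Finset V)
  leader : ℕ → Finset V → V
  sparse : ∀ l ≤ G.topLevel (4 * σ),
    G.IsSparsePartition (min G.diam ((4 * σ) ^ l)) σ I (partition l)
  top_eq : (partition (G.topLevel (4 * σ))).parts = {Finset.univ}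
  leader_mem : ∀ l ≤ G.topLevel (4 * σ), ∀ X ∈ (partition l).parts, leader l X ∈ X

/-- A single-object scheduling problem. Every node holds at most one transaction, so the set
of transactions is given as the set of the nodes that hold one. All of them need the object,
which is at `home` at the start. -/
structure Problem (V : Type u) where
  /-- cost of moving the object by one unit of distance -/
  α : ℝ
  /-- cost of moving a transaction by one unit of distance -/
  β : ℝ
  β_pos : 0 < β
  β_lt_α : β < α
  home : V
  txs : Finset V

/-- A dual-flow schedule: the object travels along a walk in the network; each transaction
travels along a walk to some node visited by the object, where it is executed. -/
structure Schedule {V : Type u} (G : WeightedGraph V) (P : Problem V) where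
  finish : V
  objectWalk : G.graph.Walk P.home finish
  meet : P.txs → V
  txWalk : ∀ t : P.txs, G.graph.Walk (t : V) (meet t)
  meet_mem : ∀ t, meet t ∈ objectWalk.support

/-- The communication cost of a schedule. -/
def Schedule.cost {V : Type u} {G : WeightedGraph V} {P : Problem V} (s : Schedule G P) : ℝ :=
  P.α * G.walkLength s.objectWalk + P.β * ∑ t : P.txs, G.walkLength (s.txWalk t)

/-- `C*`: the optimal communication cost over all schedules. -/
def optCost {V : Type u} (G : WeightedGraph V) (P : Problem V) : ℝ :=
  ⨅ s : Schedule G P, s.cost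

/-! The single-object algorithm `GlobalAware_SingleObj`. -/

namespace GlobalAware

variable {V : Type u} [Fintype V] [DecidableEq V] {G : WeightedGraph V} {σ : ℝ} {I : ℕ}
  (H : PartitionHierarchy G σ I) (P : Problem V)

/-- `γ = ⌈α / β⌉`. -/
def gamma : ℕ := ⌈P.α / P.β⌉₊

/-- The transactions that have no dedicated super-leader yet when level `l` is about to be
processed. At level `l`, all such transactions of a cluster that contains at least `2 * γ` of
them get the leader of the cluster as their dedicated super-leader. -/
def unassigned : ℕ → Finset V
  | 0 => P.txs
  | l + 1 => (unassigned l).filter fun t =>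
      (unassigned l ∩ (H.partition l).part t).card < 2 * gamma P

/-- `T̂_l`: the transactions whose dedicated super-leader is at level `l`. -/
def assignedAt (l : ℕ) : Finset V := unassigned H P l \ unassigned H P (l + 1)

/-- The leader of the level-`l` cluster that contains `t`; for `t` in `T̂_l`, this is the
dedicated super-leader of `t`. -/
def superLeader (l : ℕ) (t : V) : V := H.leader l ((H.partition l).part t)

/-- `L̂_l`: the dedicated super-leaders at level `l`. -/
def superLeadersAt (l : ℕ) : Finset V := (assignedAt H P l).image (superLeader H l)

/-- `R`: the levels that survive the pruning, that is, the levels `l = 0, …, h` with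
`|T̂_l| ≥ 8 I α / β` (the threshold is `8 I α` in units of cost in which `β = 1`). -/
def keptLevels : Finset ℕ :=
  (Finset.range (G.topLevel (4 * σ) + 1)).filter fun l =>
    8 * (I : ℝ) * (P.α / P.β) ≤ ((assignedAt H P l).card : ℝ)

/-- `S_f`: the final set of dedicated super-leaders. -/
def finalLeaders : Finset V := (keptLevels H P).biUnion (superLeadersAt H P)

/-- The transactions that are moved to, and executed at, the home node of the object: those of
the pruned levels and those that never got a dedicated super-leader. -/
def directTxs : Finset V := P.txs \ (keptLevels H P).biUnion (assignedAt H P)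

/-- The total communication cost of the algorithm when the object follows the tour `t`: the
object traverses the tour, the transactions of the kept levels move to their dedicated
super-leaders, all others move to the home node of the object. -/
def cost (t : List V) : ℝ :=
  P.α * G.tourLength P.home t
    + P.β * ∑ l ∈ keptLevels H P, ∑ x ∈ assignedAt H P l, G.dist x (superLeader H l x)
    + P.β * ∑ x ∈ directTxs H P, G.dist x P.home

end GlobalAware

end DualFlow

end

/-! ### The shortest-path metric, positions along a walk, and tours. -/

namespace DualFlow

namespace WeightedGraph

variable {V : Type u} (G : WeightedGraph V)

/-! Existence of a hierarchy: assigning every node to a point of a maximal `r`-separated set gives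
clusters of diameter at most `2 * r`. The centres of the clusters meeting an `r`-ball are separated
and lie in a ball of radius `2 * r`, so two rounds of the doubling property bound their number.

Cost bound: let `a = α / β` and fix any schedule, with object walk of length `W` and meeting points
`m x`. In units of `β` it costs at least `A = a * W + ∑ dist x (m x)`. Every cost of the algorithm
is charged to `A`, with `ρ = 4 * σ`.

The central estimate is `card_assignedAt_mul_le`: at a kept level `l`, the number of assigned
transactions times `ρ ^ l` is `O(A)`. Indeed, each of the at most `I` level-`(l-1)` clusters meeting
a ball of radius `ρ ^ (l-1)` left fewer than `2γ` transactions unassigned. Cutting the walk into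
pieces of length `ρ ^ (l-1) / 2`, only `O(γ I)` transactions per piece can have made a shorter move
to it; all others pay at least that length. The contribution of one extra piece is absorbed by the
pruning threshold `8 * I * a`.

Moving the transactions of a kept level to their super-leaders therefore costs `O(A)`. A
super-leader serves at least `2γ` transactions, so its detour from the walk, weighted by `2 * a`, is
charged to them (`sum_superLeaders_le`). The walk with these detours bounds the optimal tour
(`optTour_le_of_walk`), and the tour ratio transfers this to the tour actually used. Finally, only
`O(a)` transactions per pruned level, and `O(a)` beyond the top, go to the home node, each paying at
most `W` more than its move to `m x`. The number of levels produces the logarithm. -/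

theorem walkLength_nil (a : V) : G.walkLength (SimpleGraph.Walk.nil : G.graph.Walk a a) = 0 := by
  simp [walkLength]

theorem walkLength_cons {a b c : V} (h : G.graph.Adj a b) (p : G.graph.Walk b c) :
    G.walkLength (SimpleGraph.Walk.cons h p) = G.weight s(a, b) + G.walkLength p := by
  simp [walkLength]

theorem walkLength_append {a b c : V} (p : G.graph.Walk a b) (q : G.graph.Walk b c) :
    G.walkLength (p.append q) = G.walkLength p + G.walkLength q := by
  simp [walkLength, SimpleGraph.Walk.edges_append]

theorem walkLength_reverse {a b : V} (p : G.graph.Walk a b) :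
    G.walkLength p.reverse = G.walkLength p := by
  simp [walkLength, SimpleGraph.Walk.edges_reverse, List.map_reverse, List.sum_reverse]

theorem walkLength_nonneg {a b : V} (p : G.graph.Walk a b) : 0 ≤ G.walkLength p := by
  refine List.sum_nonneg fun x hx => ?_
  obtain ⟨e, he, rfl⟩ := List.mem_map.1 hx
  exact (G.weight_pos e (p.edges_subset_edgeSet he)).le

theorem bddBelow_walkLength (a b : V) :
    BddBelow (Set.range fun p : G.graph.Walk a b => G.walkLength p) :=
  ⟨0, by rintro _ ⟨p, rfl⟩; exact G.walkLength_nonneg p⟩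

theorem nonempty_walk (a b : V) : Nonempty (G.graph.Walk a b) := G.connected.preconnected a b

theorem dist_le_walkLength {a b : V} (p : G.graph.Walk a b) : G.dist a b ≤ G.walkLength p :=
  ciInf_le (G.bddBelow_walkLength a b) p

theorem dist_nonneg (a b : V) : 0 ≤ G.dist a b :=
  Real.iInf_nonneg fun p => G.walkLength_nonneg p

theorem dist_self (a : V) : G.dist a a = 0 :=
  le_antisymm ((G.dist_le_walkLength .nil).trans_eq (G.walkLength_nil a)) (G.dist_nonneg a a)

theorem dist_comm (a b : V) : G.dist a b = G.dist b a := by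
  have key : ∀ a b, G.dist a b ≤ G.dist b a := fun a b => by
    have := G.nonempty_walk b a
    exact le_ciInf fun p => (G.dist_le_walkLength p.reverse).trans_eq (G.walkLength_reverse p)
  exact le_antisymm (key a b) (key b a)

theorem dist_triangle (a b c : V) : G.dist a c ≤ G.dist a b + G.dist b c := by
  have := G.nonempty_walk a b
  have := G.nonempty_walk b c
  exact le_ciInf_add_ciInf fun p q =>
    (G.dist_le_walkLength (p.append q)).trans_eq (G.walkLength_append p q)

theorem dist_le_diam [Finite V] (a b : V) : G.dist a b ≤ G.diam :=
  le_ciSup (f := fun p : V × V => G.dist p.1 p.2) (Set.finite_range _).bddAbove (a, b)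

theorem diam_nonneg : 0 ≤ G.diam := Real.iSup_nonneg fun _ => G.dist_nonneg _ _

theorem mem_ball_self {v : V} {r : ℝ} (hr : 0 ≤ r) : v ∈ G.ball v r := by
  simpa [ball, G.dist_self] using hr

/-- The position of the nodes of a walk along the walk. -/
theorem exists_position {a b : V} (p : G.graph.Walk a b) : ∃ f : V → ℝ,
    (∀ w ∈ p.support, G.dist a w ≤ f w ∧ f w ≤ G.walkLength p) ∧
    ∀ w ∈ p.support, ∀ w' ∈ p.support, G.dist w w' ≤ |f w - f w'| := by
  classical
  induction p with
  | nil => exact ⟨fun _ => 0, by simp [dist_self, walkLength_nil]⟩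
  | @cons a c b h p ih =>
    obtain ⟨f, hf, hd⟩ := ih
    have hw : 0 < G.weight s(a, c) := G.weight_pos _ h
    have hac : G.dist a c ≤ G.weight s(a, c) := by
      simpa [walkLength] using G.dist_le_walkLength (SimpleGraph.Walk.cons h .nil)
    have hp := G.walkLength_nonneg p
    have key : ∀ w ∈ p.support, G.dist a w ≤ f w + G.weight s(a, c) := fun w hw => by
      linarith [G.dist_triangle a c w, (hf w hw).1]
    have hne : ∀ w ∈ (SimpleGraph.Walk.cons h p).support, w ≠ a → w ∈ p.support := by
      intro w hw hwa
      simpa [hwa] using hw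
    -- The position of a node is the length of the walk up to its first occurrence.
    refine ⟨fun w => if w = a then 0 else f w + G.weight s(a, c), fun w hws => ?_,
      fun w hws w' hws' => ?_⟩
    · rw [walkLength_cons]
      by_cases hwa : w = a
      · simp only [hwa, if_true, G.dist_self]
        exact ⟨le_rfl, by linarith⟩
      · simp only [hwa, if_false]
        exact ⟨key w (hne w hws hwa), by linarith [(hf w (hne w hws hwa)).2]⟩
    · by_cases hwa : w = a <;> by_cases hwa' : w' = a
      · simp [hwa, hwa', G.dist_self]
      · simp only [hwa, hwa', if_true, if_false, zero_sub, abs_neg]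
        exact (key w' (hne w' hws' hwa')).trans (le_abs_self _)
      · simp only [hwa, hwa', if_true, if_false, sub_zero]
        rw [G.dist_comm]
        exact (key w (hne w hws hwa)).trans (le_abs_self _)
      · simp only [hwa, hwa', if_false, add_sub_add_right_eq_sub]
        exact hd w (hne w hws hwa) w' (hne w' hws' hwa')

theorem listLength_nonneg (l : List V) : 0 ≤ G.listLength l := by
  induction l using listLength.induct with
  | case1 => simp [listLength]
  | case2 => simp [listLength]
  | case3 a b l ih => rw [listLength]; exact add_nonneg (G.dist_nonneg _ _) ih

/-- Visiting nodes in the order of the positions `g`, where `e` bounds the distance of each node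
to its position. -/
theorem listLength_append_le_of_pairwise {g e : V → ℝ} {M : ℝ} {s : V} (l : List V) (a : V)
    (hs : ∀ z ∈ a :: l, G.dist z s ≤ e z + g z) (hM : ∀ z ∈ a :: l, g z ≤ M)
    (hd : ∀ z ∈ a :: l, ∀ z' ∈ a :: l, G.dist z z' ≤ e z + |g z - g z'| + e z')
    (hp : (a :: l).Pairwise fun z z' => g z ≤ g z') :
    G.listLength (a :: (l ++ [s])) ≤ e a + 2 * (l.map e).sum + (M - g a) + M := by
  induction l generalizing a with
  | nil =>
    have := hs a (by simp)
    have := hM a (by simp)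
    simp only [List.nil_append, listLength, List.map_nil, List.sum_nil]
    linarith
  | cons b l ih =>
    have h1 := ih b (fun z hz => hs z (by simp_all)) (fun z hz => hM z (by simp_all))
      (fun z hz z' hz' => hd z (List.mem_cons_of_mem _ hz) z' (List.mem_cons_of_mem _ hz'))
      (List.pairwise_cons.1 hp).2
    -- Sorted positions make the absolute values telescope to `M - g a`; the final `M` pays for the
    -- way back to `s`.
    have h2 := hd a (by simp) b (by simp)
    have h3 : g a ≤ g b := (List.pairwise_cons.1 hp).1 b (by simp)
    rw [abs_sub_comm, abs_of_nonneg (by linarith)] at h2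
    simp only [List.cons_append, listLength, List.map_cons, List.sum_cons]
    linarith

theorem tourLength_nonneg (s : V) (t : List V) : 0 ≤ G.tourLength s t := G.listLength_nonneg _

section Tours

variable [DecidableEq V]

theorem optTour_nonneg (s : V) (S : Finset V) : 0 ≤ G.optTour s S :=
  Real.iInf_nonneg fun _ => G.tourLength_nonneg _ _

theorem optTour_le {s : V} {S : Finset V} {t : List V} (ht : IsTour s S t) :
    G.optTour s S ≤ G.tourLength s t :=
  ciInf_le (f := fun t : {t : List V // IsTour s S t} => G.tourLength s t)
    ⟨0, by rintro _ ⟨p, rfl⟩; exact G.tourLength_nonneg _ _⟩ ⟨t, ht⟩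

theorem tourRatio_one_le {s : V} {S : Finset V} {t : List V} (ht : IsTour s S t) :
    1 ≤ G.tourRatio s S t := by
  unfold tourRatio
  split_ifs with h
  · exact le_rfl
  · rw [one_le_div (lt_of_le_of_ne (G.optTour_nonneg s S) (Ne.symm h))]
    exact G.optTour_le ht

theorem one_le_tourLength (h1 : ∀ a b : V, a ≠ b → 1 ≤ G.dist a b) {s : V} {S : Finset V}
    {t : List V} (ht : IsTour s S t) (hne : t ≠ []) : 1 ≤ G.tourLength s t := by
  cases t with
  | nil => exact absurd rfl hne
  | cons a t =>
    have ha : a ∈ S.erase s := by rw [← ht.2]; simp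
    have := h1 s a (Finset.ne_of_mem_erase ha).symm
    have := G.listLength_nonneg (a :: (t ++ [s]))
    simp only [tourLength, List.cons_append, listLength]
    linarith

/-- All tours list the same nodes, and a tour with a node to visit has length at least 1. Hence a
zero optimum forces `t = []`, and the convention that the ratio is 1 is consistent. -/
theorem tourLength_eq_tourRatio_mul (h1 : ∀ a b : V, a ≠ b → 1 ≤ G.dist a b) {s : V}
    {S : Finset V} {t : List V} (ht : IsTour s S t) :
    G.tourLength s t = G.tourRatio s S t * G.optTour s S := by
  unfold tourRatio
  split_ifs with h
  · rcases eq_or_ne t [] with rfl | hne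
    · simp [tourLength, listLength, G.dist_self, h]
    · have : Nonempty {t : List V // IsTour s S t} := ⟨⟨t, ht⟩⟩
      have : 1 ≤ G.optTour s S := le_ciInf fun t' => G.one_le_tourLength h1 t'.2 (by
        rintro h0
        have h2 : t.toFinset = t'.1.toFinset := ht.2.trans t'.2.2.symm
        rw [h0] at h2
        exact hne (by simpa using h2))
      linarith
  · field_simp

/-- An optimal tour is at most twice as long as a walk together with detours to the nodes to be
visited. -/
theorem optTour_le_of_walk {s b : V} (p : G.graph.Walk s b) (S : Finset V) (w : V → V)
    (hw : ∀ z ∈ S, w z ∈ p.support) :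
    G.optTour s S ≤ 2 * G.walkLength p + 2 * ∑ z ∈ S, G.dist z (w z) := by
  classical
  obtain ⟨f, hf, hd⟩ := G.exists_position p
  -- The nodes are visited in the order in which their attachment points `w z` appear along the
  -- walk: one sweep forward, one return, and two traversals of each detour.
  let r : V → V → Prop := fun z z' => f (w z) ≤ f (w z')
  have : Std.Total r := ⟨fun a b => le_total _ _⟩
  have : IsTrans V r := ⟨fun a b c => le_trans⟩
  let t := (S.erase s).toList.insertionSort r
  have hperm : t.Perm (S.erase s).toList := List.perm_insertionSort r _
  have hpw : t.Pairwise r := List.pairwise_insertionSort r _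
  have ht : IsTour s S t := by
    refine ⟨hperm.nodup_iff.2 (Finset.nodup_toList _), ?_⟩
    rw [List.toFinset_eq_of_perm _ _ hperm, Finset.toList_toFinset]
  have hmem : ∀ z ∈ t, z ∈ S := fun z hz => by
    have := hperm.mem_iff.1 hz
    rw [Finset.mem_toList] at this
    exact Finset.mem_of_mem_erase this
  have hsum : (t.map fun z => G.dist z (w z)).sum ≤ ∑ z ∈ S, G.dist z (w z) := by
    rw [(hperm.map _).sum_eq, Finset.sum_map_toList]
    exact Finset.sum_le_sum_of_subset_of_nonneg (Finset.erase_subset _ _)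
      fun _ _ _ => G.dist_nonneg _ _
  refine (G.optTour_le ht).trans ?_
  have hback : ∀ z ∈ t, G.dist z s ≤ G.dist z (w z) + f (w z) := fun z hz => by
    have h1 := G.dist_triangle z (w z) s
    rw [G.dist_comm (w z) s] at h1
    linarith [(hf _ (hw z (hmem z hz))).1]
  have hM : ∀ z ∈ t, f (w z) ≤ G.walkLength p := fun z hz => (hf _ (hw z (hmem z hz))).2
  have hdd : ∀ z ∈ t, ∀ z' ∈ t,
      G.dist z z' ≤ G.dist z (w z) + |f (w z) - f (w z')| + G.dist z' (w z') := by
    intro z hz z' hz'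
    have h1 := hd _ (hw z (hmem z hz)) _ (hw z' (hmem z' hz'))
    have h2 := G.dist_triangle z (w z) z'
    have h3 := G.dist_triangle (w z) (w z') z'
    rw [G.dist_comm (w z') z'] at h3
    linarith
  have h0 := G.walkLength_nonneg p
  clear_value t
  cases t with
  | nil =>
    simp only [tourLength, List.nil_append, listLength, G.dist_self]
    simp only [List.map_nil, List.sum_nil] at hsum
    linarith
  | cons a l =>
    have h1 := G.listLength_append_le_of_pairwise (g := fun z => f (w z)) l a hback hM hdd hpw
    have h2 := hback a (by simp)
    rw [G.dist_comm] at h2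
    simp only [tourLength, List.cons_append, listLength]
    simp only [List.map_cons, List.sum_cons] at hsum
    linarith

end Tours

end WeightedGraph

end DualFlow

/-! ### Doubling dimension and the existence of partition hierarchies. -/

namespace DualFlow

namespace WeightedGraph

variable {V : Type u} (G : WeightedGraph V)

theorem diam_le_pow_topLevel {ρ : ℝ} (hρ : 1 < ρ) : G.diam ≤ ρ ^ G.topLevel ρ := by
  rcases G.diam_nonneg.eq_or_lt with h | h
  · rw [← h]; positivity
  · rw [← Real.rpow_natCast, ← Real.logb_le_iff_le_rpow hρ h]
    exact Nat.le_ceil _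

theorem exists_ball_cover [Fintype V] {δ : ℝ} (hδ : G.doublingDim ≤ δ) (v : V) {r : ℝ} (hr : 0 ≤ r) :
    ∃ c : Finset V, c.card ≤ ⌊(2 : ℝ) ^ (δ + 1)⌋₊ ∧ G.ball v r ⊆ ⋃ x ∈ c, G.ball x (r / 2) := by
  -- The infimum is over a nonempty set, since all nodes together cover any ball. Passing to `δ + 1`
  -- avoids having to show that it is attained.
  have hne : {δ : ℝ | ∀ (v : V) (r : ℝ), 0 ≤ r → ∃ c : Finset V,
      (c.card : ℝ) ≤ (2 : ℝ) ^ δ ∧ G.ball v r ⊆ ⋃ x ∈ c, G.ball x (r / 2)}.Nonempty := by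
    have : Nonempty V := G.connected.nonempty
    refine ⟨Real.logb 2 (Fintype.card V), fun v r hr => ⟨Finset.univ, ?_, fun x _ => ?_⟩⟩
    · rw [Real.rpow_logb (by norm_num) (by norm_num) (by exact_mod_cast Fintype.card_pos)]
      rfl
    · simp only [Set.mem_iUnion]
      exact ⟨x, Finset.mem_univ _, G.mem_ball_self (by linarith)⟩
  obtain ⟨δ', hδ', hlt⟩ := exists_lt_of_csInf_lt hne (lt_of_le_of_lt hδ (lt_add_one δ))
  obtain ⟨c, hc, hcov⟩ := hδ' v r hr
  exact ⟨c, Nat.le_floor (hc.trans (Real.rpow_le_rpow_of_exponent_le (by norm_num) hlt.le)), hcov⟩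

variable [DecidableEq V]

/-- A ball of radius `2 * r` contains a bounded number of nodes that are more than `r` apart. -/
theorem card_le_of_separated {N : ℕ} (hN : ∀ (v : V) (r : ℝ), 0 ≤ r → ∃ c : Finset V,
      c.card ≤ N ∧ G.ball v r ⊆ ⋃ x ∈ c, G.ball x (r / 2))
    {r : ℝ} (hr : 0 ≤ r) (v : V) (S : Finset V) (hS : ∀ x ∈ S, x ∈ G.ball v (2 * r))
    (hsep : ∀ x ∈ S, ∀ y ∈ S, x ≠ y → r < G.dist x y) : S.card ≤ N ^ 2 := by
  choose c hc hcov using fun v (r : {r : ℝ // 0 ≤ r}) => hN v r r.2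
  -- Halving the radius twice covers the ball by `N ^ 2` balls of radius `r / 2`, each containing at
  -- most one point of `S`.
  have hex : ∀ x ∈ S, ∃ z ∈ (c v ⟨2 * r, by linarith⟩).biUnion (c · ⟨r, hr⟩),
      x ∈ G.ball z (r / 2) := fun x hx => by
    have h1 := hcov v ⟨2 * r, by linarith⟩ (hS x hx)
    simp only [Set.mem_iUnion] at h1
    obtain ⟨y, hy, hxy⟩ := h1
    rw [mul_div_cancel_left₀ r two_ne_zero] at hxy
    have h2 := hcov y ⟨r, hr⟩ hxy
    simp only [Set.mem_iUnion] at h2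
    obtain ⟨z, hz, hxz⟩ := h2
    exact ⟨z, Finset.mem_biUnion.2 ⟨y, hy, hz⟩, hxz⟩
  choose! f hf hfx using hex
  refine (Finset.card_le_card_of_injOn f hf fun x hx y hy hxy => ?_).trans
    ((Finset.card_biUnion_le_card_mul _ _ N fun y _ => hc y _).trans ?_)
  · by_contra hne
    have h1 := hsep x hx y hy hne
    have h2 : G.dist (f x) x ≤ r / 2 := hfx x hx
    have h3 : G.dist (f y) y ≤ r / 2 := hfx y hy
    rw [← hxy] at h3
    have h4 := G.dist_triangle x (f x) y
    rw [G.dist_comm x (f x)] at h4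
    linarith
  · rw [sq]
    exact Nat.mul_le_mul_right _ (hc v _)

variable [Fintype V]

/-- A separated set of maximal cardinality is a net: a node farther than `r` from all of it could be
added. -/
theorem exists_net {r : ℝ} (hr : 0 ≤ r) : ∃ S : Finset V,
    (∀ x ∈ S, ∀ y ∈ S, x ≠ y → r < G.dist x y) ∧ ∀ v, ∃ x ∈ S, G.dist x v ≤ r := by
  classical
  obtain ⟨S, hS, hmax⟩ := Finset.exists_max_image
    (Finset.univ.filter fun S : Finset V => ∀ x ∈ S, ∀ y ∈ S, x ≠ y → r < G.dist x y)
    Finset.card ⟨∅, by simp⟩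
  have hsep := (Finset.mem_filter.1 hS).2
  refine ⟨S, hsep, fun v => ?_⟩
  by_contra! hv
  have hvS : v ∉ S := fun h => by
    have := hv v h
    rw [G.dist_self] at this
    linarith
  have := hmax (insert v S) (Finset.mem_filter.2 ⟨Finset.mem_univ _, fun x hx y hy hxy => by
    rcases Finset.mem_insert.1 hx with rfl | hx <;> rcases Finset.mem_insert.1 hy with rfl | hy
    · exact absurd rfl hxy
    · rw [G.dist_comm]; exact hv y ‹_›
    · exact hv x ‹_›
    · exact hsep x ‹_› y ‹_› hxy⟩)
  rw [Finset.card_insert_of_notMem hvS] at this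
  omega

theorem exists_isSparsePartition {N : ℕ} (hN : ∀ (v : V) (r : ℝ), 0 ≤ r → ∃ c : Finset V,
      c.card ≤ N ∧ G.ball v r ⊆ ⋃ x ∈ c, G.ball x (r / 2)) {r : ℝ} (hr : 0 ≤ r) :
    ∃ P : Finpartition (Finset.univ : Finset V), G.IsSparsePartition r 2 (N ^ 2) P := by
  obtain ⟨S, hsep, hnet⟩ := G.exists_net hr
  choose g hgS hg using hnet
  have hparts : ∀ X ∈ (Finpartition.ofSetoid (Setoid.ker g)).parts,
      ∃ a, X = Finset.univ.filter fun b => g a = g b := fun X hX => by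
    obtain ⟨a, -, rfl⟩ := Finset.mem_image.1 hX
    exact ⟨a, Finset.filter_congr fun b _ => by simp⟩
  refine ⟨Finpartition.ofSetoid (Setoid.ker g), fun X hX a ha b hb => ?_, fun v => ?_⟩
  · obtain ⟨c, rfl⟩ := hparts X hX
    simp only [Finset.mem_filter, Finset.mem_univ, true_and] at ha hb
    have h1 := G.dist_triangle a (g c) b
    rw [G.dist_comm a (g c)] at h1
    have h2 := hg a
    have h3 := hg b
    rw [← ha] at h2
    rw [← hb] at h3
    linarith
  · have hsub : {X : Finset V | X ∈ (Finpartition.ofSetoid (Setoid.ker g)).parts ∧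
        ((X : Set V) ∩ G.ball v r).Nonempty} ⊆
        ((S.filter fun z => G.dist v z ≤ 2 * r).image
          fun z => Finset.univ.filter fun b => z = g b : Finset (Finset V)) := by
      rintro X ⟨hX, x, hxX, hxv⟩
      obtain ⟨a, rfl⟩ := hparts X hX
      have hax : g a = g x := by simpa using hxX
      have hxv' : G.dist v x ≤ r := hxv
      refine Finset.mem_coe.2 (Finset.mem_image.2 ⟨g a, Finset.mem_filter.2 ⟨hgS a, ?_⟩, rfl⟩)
      have h1 := G.dist_triangle v x (g a)
      have h2 := hg x
      rw [hax, G.dist_comm x] at h1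
      rw [hax]
      linarith
    refine (Set.ncard_le_ncard hsub (Finset.finite_toSet _)).trans ?_
    rw [Set.ncard_coe_finset]
    exact Finset.card_image_le.trans (G.card_le_of_separated hN hr v _
      (fun x hx => (Finset.mem_filter.1 hx).2) fun x hx y hy =>
        hsep x (Finset.mem_filter.1 hx).1 y (Finset.mem_filter.1 hy).1)

theorem nonempty_partitionHierarchy {N : ℕ} (hN : ∀ (v : V) (r : ℝ), 0 ≤ r → ∃ c : Finset V,
      c.card ≤ N ∧ G.ball v r ⊆ ⋃ x ∈ c, G.ball x (r / 2)) :
    Nonempty (PartitionHierarchy G 2 (N ^ 2)) := by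
  classical
  obtain ⟨v₀⟩ : Nonempty V := G.connected.nonempty
  have hN1 : 1 ≤ N ^ 2 := by
    obtain ⟨c, hc, hcov⟩ := hN v₀ 0 le_rfl
    have h := hcov (G.mem_ball_self le_rfl)
    simp only [Set.mem_iUnion] at h
    obtain ⟨x, hx, -⟩ := h
    exact Nat.one_le_pow _ _ ((Finset.card_pos.2 ⟨x, hx⟩).trans_le hc)
  choose Q hQ using fun l : ℕ => G.exists_isSparsePartition hN
    (r := min G.diam ((4 * 2) ^ l)) (le_min G.diam_nonneg (by positivity))
  let T : Finpartition (Finset.univ : Finset V) :=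
    Finpartition.indiscrete (Finset.univ_nonempty_iff.2 ⟨v₀⟩).ne_empty
  -- The net partition at the top level need not be trivial, so it is replaced by the single
  -- cluster. This remains sparse because `ρ ^ h ≥ D`, and `hN1` provides room for one cluster.
  refine ⟨⟨fun l => if l = G.topLevel (4 * 2) then T else Q l,
    fun _ X => if h : X.Nonempty then h.choose else v₀, fun l _ => ?_, ?_, fun l _ X hX => ?_⟩⟩
  · by_cases hl : l = G.topLevel (4 * 2)
    · subst hl
      simp only [if_true]
      refine ⟨fun X _ a _ b _ => ?_, fun v => ?_⟩
      · rw [min_eq_left (G.diam_le_pow_topLevel (by norm_num))]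
        linarith [G.dist_le_diam a b, G.diam_nonneg]
      · have hsub : {X : Finset V | X ∈ T.parts ∧ ((X : Set V) ∩ G.ball v
            (min G.diam ((4 * 2) ^ G.topLevel (4 * 2)))).Nonempty} ⊆ {Finset.univ} :=
          fun X hX => by simpa [T] using hX.1
        exact (Set.ncard_le_ncard hsub (Set.finite_singleton _)).trans
          ((Set.ncard_singleton _).trans_le hN1)
    · simp only [hl, if_false]
      exact hQ l
  · simp [T]
  · have hne : X.Nonempty := Finpartition.nonempty_of_mem_parts _ hX
    simp only [hne, dif_pos]
    exact hne.choose_spec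

end WeightedGraph

end DualFlow

/-! ### Combinatorics of the algorithm: counting transactions and super-leaders. -/

namespace DualFlow

namespace GlobalAware

open Finset

theorem ratio_le_gamma {V : Type u} (P : Problem V) : P.α / P.β ≤ gamma P := Nat.le_ceil _

theorem one_lt_ratio {V : Type u} (P : Problem V) : 1 < P.α / P.β := (one_lt_div P.β_pos).2 P.β_lt_α

theorem gamma_le {V : Type u} (P : Problem V) : (gamma P : ℝ) ≤ 2 * (P.α / P.β) := by
  have h1 := one_lt_ratio P
  have := Nat.ceil_lt_add_one (zero_le_one.trans h1.le)
  unfold gamma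
  linarith

theorem one_le_gamma {V : Type u} (P : Problem V) : 1 ≤ gamma P :=
  Nat.one_le_iff_ne_zero.2 fun h => by
    have h1 := ratio_le_gamma P
    rw [h, Nat.cast_zero] at h1
    linarith [one_lt_ratio P]

/-- Since `4 * σ ≥ 2`, the logarithm to base `4 * σ` is at most the binary one; rounding up and
counting level 0 add at most 1 each. -/
theorem topLevel_add_one_le {V : Type u} {G : WeightedGraph V} {σ : ℝ} (hσ : 1 ≤ σ) (hD : 1 ≤ G.diam) :
    (G.topLevel (4 * σ) + 1 : ℝ) ≤ 3 * max 1 (Real.logb 2 G.diam) := by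
  have h1 : Real.logb (4 * σ) G.diam ≤ Real.logb 2 G.diam := by
    unfold Real.logb
    exact div_le_div_of_nonneg_left (Real.log_nonneg hD) (Real.log_pos (by norm_num))
      (Real.log_le_log (by norm_num) (by linarith))
  have h2 := Nat.ceil_lt_add_one (Real.logb_nonneg (b := 4 * σ) (by linarith) hD)
  have h3 := le_max_left 1 (Real.logb 2 G.diam)
  have h4 := le_max_right 1 (Real.logb 2 G.diam)
  unfold WeightedGraph.topLevel
  linarith

variable {V : Type u} [Fintype V] [DecidableEq V] {G : WeightedGraph V} {σ : ℝ} {I : ℕ}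
  (H : PartitionHierarchy G σ I) (P : Problem V)

theorem unassigned_succ_subset (l : ℕ) : unassigned H P (l + 1) ⊆ unassigned H P l :=
  filter_subset _ _

theorem unassigned_subset_txs (l : ℕ) : unassigned H P l ⊆ P.txs := by
  induction l with
  | zero => exact Subset.rfl
  | succ l ih => exact (unassigned_succ_subset H P l).trans ih

theorem assignedAt_subset_txs (l : ℕ) : assignedAt H P l ⊆ P.txs :=
  sdiff_subset.trans (unassigned_subset_txs H P l)

theorem txs_subset_assigned_union (l : ℕ) :
    P.txs ⊆ (range l).biUnion (assignedAt H P) ∪ unassigned H P l := by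
  induction l with
  | zero => simp [unassigned]
  | succ l ih =>
    intro x hx
    rcases mem_union.1 (ih hx) with h | h
    · obtain ⟨k, hk, hxk⟩ := mem_biUnion.1 h
      exact mem_union_left _ (mem_biUnion.2 ⟨k, mem_range.2 (by have := mem_range.1 hk; omega), hxk⟩)
    · by_cases h' : x ∈ unassigned H P (l + 1)
      · exact mem_union_right _ h'
      · exact mem_union_left _ (mem_biUnion.2 ⟨l, by simp, mem_sdiff.2 ⟨h, h'⟩⟩)

/-- A cluster assigns all of its remaining transactions or none, so those in the cluster of `x` are
all assigned together with `x`. -/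
theorem two_gamma_le_card_filter {l : ℕ} {x : V} (hx : x ∈ assignedAt H P l) :
    2 * gamma P ≤ ((assignedAt H P l).filter fun y => superLeader H l y = superLeader H l x).card := by
  have hx' := mem_sdiff.1 hx
  have hcard : 2 * gamma P ≤ (unassigned H P l ∩ (H.partition l).part x).card := by
    by_contra! h
    exact hx'.2 (mem_filter.2 ⟨hx'.1, h⟩)
  refine hcard.trans (card_le_card fun y hy => ?_)
  have hpart : (H.partition l).part y = (H.partition l).part x :=
    (H.partition l).part_eq_of_mem ((H.partition l).part_mem.2 (mem_univ x)) (mem_inter.1 hy).2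
  refine mem_filter.2 ⟨mem_sdiff.2 ⟨(mem_inter.1 hy).1, fun h => ?_⟩, ?_⟩
  · have := (mem_filter.1 h).2
    rw [hpart] at this
    omega
  · rw [superLeader, superLeader, hpart]

/-- The parameters `σ` and `I` of a partition hierarchy of a nontrivial graph. -/
theorem one_le_sigma (H : PartitionHierarchy G σ I) (hD : 1 ≤ G.diam) : 1 ≤ σ := by
  obtain ⟨v⟩ : Nonempty V := G.connected.nonempty
  have h0 : 0 ≤ σ := by
    -- Level 0 gives `σ ≥ 0`; the single cluster at the top level then gives `D ≤ D * σ`.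
    have h := (H.sparse 0 (Nat.zero_le _)).1 _ ((H.partition 0).part_mem.2 (mem_univ v)) v
      ((H.partition 0).mem_part_self.2 (mem_univ v)) v
      ((H.partition 0).mem_part_self.2 (mem_univ v))
    rwa [G.dist_self, pow_zero, min_eq_right hD, one_mul] at h
  have h1 : G.diam ≤ G.diam * σ := by
    have : Nonempty (V × V) := ⟨(v, v)⟩
    refine ciSup_le fun p => ?_
    refine ((H.sparse _ le_rfl).1 univ (by rw [H.top_eq]; simp) p.1 (mem_univ _) p.2
      (mem_univ _)).trans (mul_le_mul_of_nonneg_right (min_le_left _ _) h0)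
  exact le_of_mul_le_mul_left (by linarith) (zero_lt_one.trans_le hD)

theorem dist_superLeader_le (hσ : 0 ≤ σ) {l : ℕ} (hl : l ≤ G.topLevel (4 * σ)) (x : V) :
    G.dist x (superLeader H l x) ≤ σ * (4 * σ) ^ l := by
  have hp := (H.partition l).part_mem.2 (mem_univ x)
  refine ((H.sparse l hl).1 _ hp x ((H.partition l).mem_part_self.2 (mem_univ x)) _
    (H.leader_mem l hl _ hp)).trans ?_
  rw [mul_comm σ]
  exact mul_le_mul_of_nonneg_right (min_le_right _ _) hσ

/-- Capping the radius at `D` does not change the ball, as a ball of radius `D` is everything. -/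
theorem ncard_clusters_le {l : ℕ} (hl : l ≤ G.topLevel (4 * σ)) (v : V) :
    {X : Finset V | X ∈ (H.partition l).parts ∧
      ((X : Set V) ∩ G.ball v ((4 * σ) ^ l)).Nonempty}.ncard ≤ I := by
  have h : G.ball v (min G.diam ((4 * σ) ^ l)) = G.ball v ((4 * σ) ^ l) := by
    ext x
    simp [WeightedGraph.ball, G.dist_le_diam]
  rw [← h]
  exact (H.sparse l hl).2 v

theorem one_le_I (H : PartitionHierarchy G σ I) : 1 ≤ I := by
  obtain ⟨v⟩ : Nonempty V := G.connected.nonempty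
  refine le_trans ?_ (ncard_clusters_le H (Nat.zero_le _) v)
  refine (Set.ncard_pos (Set.toFinite _)).2 ⟨(H.partition 0).part v,
    (H.partition 0).part_mem.2 (mem_univ v), v, ?_, G.mem_ball_self (by simp)⟩
  exact mem_coe.2 ((H.partition 0).mem_part_self.2 (mem_univ v))

/-- Few transactions near a node are left for level `l`. -/
theorem card_unassigned_near_le (h1 : ∀ a b : V, a ≠ b → 1 ≤ G.dist a b) (hD : 1 ≤ G.diam)
    {l : ℕ} (hl : l ≤ G.topLevel (4 * σ)) (v : V) :
    ((unassigned H P l).filter fun x => G.dist v x ≤ (4 * σ) ^ l / (4 * σ)).card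
      ≤ 2 * gamma P * I := by
  have hσ := one_le_sigma H hD
  cases l with
  | zero =>
    -- At level 0 the radius is `1 / (4 * σ) < 1`, so the ball contains only `v`.
    have hsub : (unassigned H P 0).filter (fun x => G.dist v x ≤ (4 * σ) ^ 0 / (4 * σ)) ⊆ {v} := by
      intro x hx
      by_contra hne
      have h2 := (mem_filter.1 hx).2
      have h3 := h1 v x (by rintro rfl; simp at hne)
      rw [pow_zero, le_div_iff₀ (by linarith)] at h2
      nlinarith
    refine (card_le_card hsub).trans ?_
    have := one_le_gamma P
    have := one_le_I H
    rw [card_singleton]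
    nlinarith
  | succ l =>
    rw [pow_succ, mul_div_cancel_right₀ _ (by linarith)]
    set S := (unassigned H P (l + 1)).filter fun x => G.dist v x ≤ (4 * σ) ^ l
    -- Transactions are grouped by their cluster one level below: fewer than `2γ` survive in each,
    -- and at most `I` of these clusters meet the ball.
    refine (card_le_mul_card_image (f := (H.partition l).part) S (2 * gamma P) ?_).trans
      (Nat.mul_le_mul_left _ ?_)
    · intro X hX
      obtain ⟨y, hy, rfl⟩ := mem_image.1 hX
      refine le_trans (card_le_card fun x hx => ?_) (mem_filter.1 (mem_filter.1 hy).1).2.le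
      obtain ⟨hxS, hxy⟩ := mem_filter.1 hx
      refine mem_inter.2 ⟨unassigned_succ_subset H P l (mem_filter.1 hxS).1, ?_⟩
      rw [← hxy]
      exact (H.partition l).mem_part_self.2 (mem_univ x)
    · rw [← Set.ncard_coe_finset]
      refine (Set.ncard_le_ncard ?_ (Set.toFinite _)).trans (ncard_clusters_le H (l := l) (by omega) v)
      intro X hX
      obtain ⟨y, hy, rfl⟩ := mem_image.1 (mem_coe.1 hX)
      exact ⟨(H.partition l).part_mem.2 (mem_univ y), y,
        mem_coe.2 ((H.partition l).mem_part_self.2 (mem_univ y)), (mem_filter.1 hy).2⟩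

variable {P}

/-- Few of the transactions that are left for level `l` are moved a short distance only. -/
theorem card_short_moves_le (h1 : ∀ a b : V, a ≠ b → 1 ≤ G.dist a b) (hD : 1 ≤ G.diam)
    {l : ℕ} (hl : l ≤ G.topLevel (4 * σ)) {s : ℝ} (hs : 2 * s = (4 * σ) ^ l / (4 * σ))
    {b : V} (p : G.graph.Walk P.home b) (m : V → V) (hm : ∀ x ∈ P.txs, m x ∈ p.support) :
    (((assignedAt H P l).filter fun x => G.dist x (m x) < s).card : ℝ)
      ≤ 2 * gamma P * I * (G.walkLength p / s + 1) := by
  have hσ := one_le_sigma H hD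
  have hs0 : 0 < s := by
    have : 0 < (4 * σ) ^ l / (4 * σ) := by positivity
    linarith
  obtain ⟨f, hf, hd⟩ := G.exists_position p
  set S := (assignedAt H P l).filter fun x => G.dist x (m x) < s
  have hS : ∀ x ∈ S, x ∈ unassigned H P l ∧ m x ∈ p.support ∧ G.dist x (m x) < s := fun x hx =>
    ⟨(mem_sdiff.1 (mem_filter.1 hx).1).1,
      hm x (assignedAt_subset_txs H P l (mem_filter.1 hx).1), (mem_filter.1 hx).2⟩
  have hf0 : ∀ x ∈ S, 0 ≤ f (m x) := fun x hx =>
    (G.dist_nonneg _ _).trans (hf _ (hS x hx).2.1).1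
  have hcount : S.card ≤ 2 * gamma P * I * (⌊G.walkLength p / s⌋₊ + 1) := by
    -- Transactions are grouped by the piece of length `s` containing their meeting point. Within
    -- one piece, all lie within `2 * s` of the meeting point of any one of them.
    refine (card_le_mul_card_image (f := fun x => ⌊f (m x) / s⌋₊) S (2 * gamma P * I) ?_).trans
      (Nat.mul_le_mul_left _ ?_)
    · intro k hk
      obtain ⟨y, hy, rfl⟩ := mem_image.1 hk
      refine le_trans (card_le_card fun x hx => ?_) (card_unassigned_near_le H P h1 hD hl (m y))
      obtain ⟨hxS, hxy⟩ := mem_filter.1 hx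
      refine mem_filter.2 ⟨(hS x hxS).1, ?_⟩
      have hlt : |f (m y) - f (m x)| < s := by
        have hx0 := div_nonneg (hf0 x hxS) hs0.le
        have hy0 := div_nonneg (hf0 y hy) hs0.le
        have hx1 := Nat.floor_le hx0
        have hx2 := Nat.lt_floor_add_one (f (m x) / s)
        have hy1 := Nat.floor_le hy0
        have hy2 := Nat.lt_floor_add_one (f (m y) / s)
        rw [hxy] at hx1 hx2
        have h3 : |f (m y) / s - f (m x) / s| < 1 := abs_lt.2 ⟨by linarith, by linarith⟩
        rwa [← sub_div, abs_div, abs_of_pos hs0, div_lt_one hs0] at h3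
      have h4 := hd _ (hS y hy).2.1 _ (hS x hxS).2.1
      have h5 := G.dist_triangle (m y) (m x) x
      rw [G.dist_comm (m x) x] at h5
      have h6 := (hS x hxS).2.2
      linarith
    · refine (card_le_card (t := range (⌊G.walkLength p / s⌋₊ + 1)) fun k hk => ?_).trans_eq
        (card_range _)
      obtain ⟨y, hy, rfl⟩ := mem_image.1 hk
      refine mem_range.2 (Nat.lt_succ_of_le (Nat.floor_le_floor ?_))
      exact div_le_div_of_nonneg_right (hf _ (hS y hy).2.1).2 hs0.le
  have hfl := Nat.floor_le (div_nonneg (G.walkLength_nonneg p) hs0.le)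
  calc (S.card : ℝ) ≤ 2 * gamma P * I * (⌊G.walkLength p / s⌋₊ + 1) := by exact_mod_cast hcount
    _ ≤ _ := by gcongr

/-- The optimal cost is large compared to the number of transactions of a kept level. -/
theorem card_assignedAt_mul_le (h1 : ∀ a b : V, a ≠ b → 1 ≤ G.dist a b) (hD : 1 ≤ G.diam)
    {l : ℕ} (hl : l ∈ keptLevels H P)
    {b : V} (p : G.graph.Walk P.home b) (m : V → V) (hm : ∀ x ∈ P.txs, m x ∈ p.support) {A : ℝ}
    (hA : P.α / P.β * G.walkLength p + ∑ x ∈ P.txs, G.dist x (m x) ≤ A) :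
    (assignedAt H P l).card * (4 * σ) ^ l ≤ 16 * σ * (4 * I + 1) * A := by
  have hσ := one_le_sigma H hD
  obtain ⟨hl, hn⟩ := mem_filter.1 hl
  have ha := one_lt_ratio P
  have hg := gamma_le P
  have hW := G.walkLength_nonneg p
  set a := P.α / P.β
  set W := G.walkLength p
  -- Half of `ρ ^ (l-1)`, written with a division to cover `l = 0`.
  set s := (4 * σ) ^ l / (4 * σ) / 2 with hs
  have hs0 : 0 < s := by positivity
  have hnear := card_short_moves_le H h1 hD (Nat.lt_succ_iff.1 (mem_range.1 hl))
    (s := s) (by rw [hs]; ring) p m hm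
  have hsplit := card_filter_add_card_filter_not (s := assignedAt H P l)
    (fun x => G.dist x (m x) < s)
  have hfar : (((assignedAt H P l).filter fun x => ¬ G.dist x (m x) < s).card : ℝ) * s
      ≤ ∑ x ∈ P.txs, G.dist x (m x) := by
    rw [← nsmul_eq_mul]
    refine (card_nsmul_le_sum _ (fun x => G.dist x (m x)) s
      fun x hx => not_lt.1 (mem_filter.1 hx).2).trans ?_
    exact sum_le_sum_of_subset_of_nonneg
      ((filter_subset _ _).trans (assignedAt_subset_txs H P l)) fun _ _ _ => G.dist_nonneg _ _
  have hD0 : 0 ≤ ∑ x ∈ P.txs, G.dist x (m x) := sum_nonneg fun _ _ => G.dist_nonneg _ _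
  have hnear' : (((assignedAt H P l).filter fun x => G.dist x (m x) < s).card : ℝ) * s
      ≤ 4 * I * (a * W) + 4 * I * a * s := by
    calc _ ≤ 2 * gamma P * I * (W / s + 1) * s := by gcongr
      _ = 2 * gamma P * I * (W + s) := by field_simp
      _ ≤ 2 * (2 * a) * I * (W + s) := by gcongr
      _ = _ := by ring
  have hsplit' : ((assignedAt H P l).card : ℝ) * s =
      (((assignedAt H P l).filter fun x => G.dist x (m x) < s).card : ℝ) * s +
      (((assignedAt H P l).filter fun x => ¬ G.dist x (m x) < s).card : ℝ) * s := by
    rw [← add_mul, ← hsplit]; push_cast; ring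
  -- The pruning threshold makes the additive term `4 * I * a * s` at most half of the left side of
  -- `hfin`, so it can be absorbed there.
  have hn' := mul_le_mul_of_nonneg_right hn hs0.le
  have haW : 0 ≤ a * W := by positivity
  have hIA : (I : ℝ) * (a * W) ≤ I * A := by gcongr; linarith
  have hfin : ((assignedAt H P l).card : ℝ) * s ≤ 2 * (4 * I + 1) * A := by linarith
  have hpow : (4 * σ) ^ l = 8 * σ * s := by rw [hs]; field_simp; norm_num
  calc ((assignedAt H P l).card : ℝ) * (4 * σ) ^ l
      = 8 * σ * ((assignedAt H P l).card * s) := by rw [hpow]; ring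
    _ ≤ 8 * σ * (2 * (4 * I + 1) * A) := by gcongr
    _ = _ := by ring

/-- The detours from a walk to the dedicated super-leaders of one level. -/
theorem sum_superLeaders_le (hσ : 0 ≤ σ) {l : ℕ} (hl : l ≤ G.topLevel (4 * σ)) (m e : V → V)
    (he : ∀ z, ∀ x ∈ P.txs, G.dist z (e z) ≤ G.dist z (m x)) :
    2 * (P.α / P.β) * ∑ z ∈ superLeadersAt H P l, G.dist z (e z) ≤
      (assignedAt H P l).card * (σ * (4 * σ) ^ l) + ∑ x ∈ P.txs, G.dist x (m x) := by
  have hg := ratio_le_gamma P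
  calc 2 * (P.α / P.β) * ∑ z ∈ superLeadersAt H P l, G.dist z (e z)
      = ∑ z ∈ superLeadersAt H P l, 2 * (P.α / P.β) * G.dist z (e z) := mul_sum _ _ _
    _ ≤ ∑ z ∈ superLeadersAt H P l, ∑ x ∈ assignedAt H P l with superLeader H l x = z,
          (σ * (4 * σ) ^ l + G.dist x (m x)) := by
        refine sum_le_sum fun z hz => ?_
        obtain ⟨y, hy, rfl⟩ := mem_image.1 hz
        have hc : (2 * gamma P : ℝ) ≤ ((assignedAt H P l).filter
          fun x => superLeader H l x = superLeader H l y).card := by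
          exact_mod_cast two_gamma_le_card_filter H P hy
        -- The factor `2 * a` is at most the number of transactions served by the super-leader; each
        -- of them bounds the detour through its own meeting point.
        refine le_trans (mul_le_mul_of_nonneg_right (by linarith) (G.dist_nonneg _ _))
          ((nsmul_eq_mul _ _).symm.trans_le (card_nsmul_le_sum _ _ _ fun x hx => ?_))
        obtain ⟨hx, hxy⟩ := mem_filter.1 hx
        have h2 := he (superLeader H l y) x (assignedAt_subset_txs H P l hx)
        have h3 := G.dist_triangle (superLeader H l y) x (m x)
        have h4 := dist_superLeader_le H hσ hl x
        rw [hxy, G.dist_comm] at h4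
        linarith
    _ = ∑ x ∈ assignedAt H P l, (σ * (4 * σ) ^ l + G.dist x (m x)) :=
        sum_fiberwise_of_maps_to (fun x hx => mem_image_of_mem _ hx) _
    _ ≤ _ := by
        rw [sum_add_distrib, sum_const, nsmul_eq_mul]
        gcongr
        · exact fun _ _ _ => G.dist_nonneg _ _
        · exact assignedAt_subset_txs H P l

theorem card_keptLevels_le : (keptLevels H P).card ≤ G.topLevel (4 * σ) + 1 :=
  (card_filter_le _ _).trans_eq (card_range _)

/-- Each pruned level contributes less than the threshold. At the top level the only cluster is the
whole graph, so fewer than `2γ ≤ 4 * a` transactions can remain after it. -/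
theorem card_directTxs_le :
    ((directTxs H P).card : ℝ) ≤
      (G.topLevel (4 * σ) + 1) * (8 * I * (P.α / P.β)) + 4 * (P.α / P.β) := by
  set h := G.topLevel (4 * σ) with hh
  have hsub : directTxs H P ⊆
      (range (h + 1) \ keptLevels H P).biUnion (assignedAt H P) ∪ unassigned H P (h + 1) := by
    intro x hx
    obtain ⟨hx, hx'⟩ := mem_sdiff.1 hx
    rcases mem_union.1 (txs_subset_assigned_union H P (h + 1) hx) with h2 | h2
    · obtain ⟨l, hl, hxl⟩ := mem_biUnion.1 h2
      exact mem_union_left _ (mem_biUnion.2 ⟨l, mem_sdiff.2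
        ⟨hl, fun h3 => hx' (mem_biUnion.2 ⟨l, h3, hxl⟩)⟩, hxl⟩)
    · exact mem_union_right _ h2
  have htop : (unassigned H P (h + 1)).card ≤ 2 * gamma P := by
    rcases (unassigned H P (h + 1)).eq_empty_or_nonempty with h0 | ⟨x, hx⟩
    · simp [h0]
    · have h2 := (mem_filter.1 hx).2
      have h3 : (H.partition h).part x = univ :=
        (H.partition h).part_eq_of_mem (by rw [hh, H.top_eq]; simp) (mem_univ x)
      rw [h3, inter_univ] at h2
      exact (card_le_card (unassigned_succ_subset H P h)).trans h2.le
  have hcard := (card_le_card hsub).trans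
    ((card_union_le _ _).trans (Nat.add_le_add card_biUnion_le htop))
  have hcard' : ((directTxs H P).card : ℝ) ≤
      ∑ l ∈ range (h + 1) \ keptLevels H P, ((assignedAt H P l).card : ℝ) + 2 * gamma P := by
    exact_mod_cast hcard
  have hsum : ∑ l ∈ range (h + 1) \ keptLevels H P, ((assignedAt H P l).card : ℝ) ≤
      (range (h + 1) \ keptLevels H P).card * (8 * I * (P.α / P.β)) := by
    rw [← nsmul_eq_mul]
    refine sum_le_card_nsmul _ _ _ fun l hl => ?_
    obtain ⟨hl, hl'⟩ := mem_sdiff.1 hl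
    by_contra! h2
    exact hl' (mem_filter.2 ⟨hl, h2.le⟩)
  have hle : ((range (h + 1) \ keptLevels H P).card : ℝ) ≤ h + 1 := by
    exact_mod_cast (card_le_card sdiff_subset).trans_eq (card_range _)
  have ha := one_lt_ratio P
  have h5 : ((range (h + 1) \ keptLevels H P).card : ℝ) * (8 * I * (P.α / P.β)) ≤
      (h + 1) * (8 * I * (P.α / P.β)) := by gcongr
  linarith [gamma_le P]

end GlobalAware

end DualFlow

/-! ### Comparison with an arbitrary schedule and assembly of the bound. -/

namespace DualFlow

namespace WeightedGraph

theorem nonempty_schedule {V : Type u} (G : WeightedGraph V) (P : Problem V) :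
    Nonempty (Schedule G P) := by
  exact ⟨⟨P.home, .nil, fun _ => P.home, fun t => (G.nonempty_walk (t : V) P.home).some,
    fun _ => by simp⟩⟩

end WeightedGraph

namespace GlobalAware

open Finset

variable {V : Type u} [Fintype V] [DecidableEq V] {G : WeightedGraph V} {σ : ℝ} {I : ℕ}
  (H : PartitionHierarchy G σ I) {P : Problem V}

theorem sum_biUnion_le {ι κ : Type*} [DecidableEq κ] {s : Finset ι} {f : ι → Finset κ}
    {g : κ → ℝ} (hg : ∀ z, 0 ≤ g z) : ∑ z ∈ s.biUnion f, g z ≤ ∑ i ∈ s, ∑ z ∈ f i, g z := by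
  classical
  induction s using Finset.induction_on with
  | empty => simp
  | insert i s hi ih =>
    rw [biUnion_insert, sum_insert hi]
    have h := sum_union_inter (s₁ := f i) (s₂ := s.biUnion f) (f := g)
    have h0 : 0 ≤ ∑ z ∈ f i ∩ s.biUnion f, g z := sum_nonneg fun z _ => hg z
    linarith

/-- The distances of the transactions to the home node of the object. -/
theorem sum_directTxs_le {b : V} (p : G.graph.Walk P.home b) (m : V → V)
    (hm : ∀ x ∈ P.txs, m x ∈ p.support) :
    ∑ x ∈ directTxs H P, G.dist x P.home ≤
      ∑ x ∈ P.txs, G.dist x (m x) + (directTxs H P).card * G.walkLength p := by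
  obtain ⟨f, hf, -⟩ := G.exists_position p
  calc ∑ x ∈ directTxs H P, G.dist x P.home
      ≤ ∑ x ∈ directTxs H P, (G.dist x (m x) + G.walkLength p) := by
        refine sum_le_sum fun x hx => ?_
        have h1 := hf _ (hm x (mem_sdiff.1 hx).1)
        have h2 := G.dist_triangle x (m x) P.home
        rw [G.dist_comm (m x)] at h2
        linarith
    _ ≤ _ := by
        rw [sum_add_distrib, sum_const, nsmul_eq_mul]
        gcongr
        · exact fun _ _ _ => G.dist_nonneg _ _
        · exact sdiff_subset

/-- The cost of the algorithm in units of `β`, compared to an object walk `p` and meeting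
points `m`. -/
theorem cost_le_of_walk (h1 : ∀ a b : V, a ≠ b → 1 ≤ G.dist a b) (hD : 1 ≤ G.diam)
    {t : List V} (ht : IsTour P.home (finalLeaders H P) t)
    {b : V} (p : G.graph.Walk P.home b) (m : V → V) (hm : ∀ x ∈ P.txs, m x ∈ p.support) {A : ℝ}
    (hA : P.α / P.β * G.walkLength p + ∑ x ∈ P.txs, G.dist x (m x) = A) :
    P.α / P.β * G.tourLength P.home t
      + ∑ l ∈ keptLevels H P, ∑ x ∈ assignedAt H P l, G.dist x (superLeader H l x)
      + ∑ x ∈ directTxs H P, G.dist x P.home ≤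
    (24 * I + 13 + 96 * σ ^ 2 * (4 * I + 1)) * (A * G.tourRatio P.home (finalLeaders H P) t *
      max 1 (Real.logb 2 G.diam)) := by
  have hσ := one_le_sigma H hD
  have ha := one_lt_ratio P
  have hM := topLevel_add_one_le hσ hD
  have hR := G.tourRatio_one_le ht
  have hM1 : 1 ≤ max 1 (Real.logb 2 G.diam) := le_max_left _ _
  have hW := G.walkLength_nonneg p
  have hS : 0 ≤ ∑ x ∈ P.txs, G.dist x (m x) := sum_nonneg fun _ _ => G.dist_nonneg _ _
  rw [G.tourLength_eq_tourRatio_mul h1 ht]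
  have hdirect := sum_directTxs_le H p m hm
  have hcard := card_directTxs_le H (P := P)
  have hkept : ((keptLevels H P).card : ℝ) ≤ G.topLevel (4 * σ) + 1 := by
    exact_mod_cast card_keptLevels_le H
  have hlev : ∀ l ∈ keptLevels H P, l ≤ G.topLevel (4 * σ) := fun l hl =>
    Nat.lt_succ_iff.1 (mem_range.1 (mem_filter.1 hl).1)
  have hone : ∀ l ∈ keptLevels H P, ((assignedAt H P l).card : ℝ) * (σ * (4 * σ) ^ l) ≤
      16 * σ ^ 2 * (4 * I + 1) * A := fun l hl => by
    have h := mul_le_mul_of_nonneg_left (card_assignedAt_mul_le H h1 hD hl p m hm hA.le)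
      (by linarith : 0 ≤ σ)
    linarith
  -- Each super-leader detours from the nearest node of the walk, so the meeting point of any
  -- transaction it serves bounds the detour.
  obtain ⟨e, hep, he⟩ : ∃ e : V → V, (∀ z, e z ∈ p.support) ∧
      ∀ z, ∀ x ∈ P.txs, G.dist z (e z) ≤ G.dist z (m x) := by
    choose e hep he using fun z => p.support.toFinset.exists_min_image (G.dist z)
      ⟨P.home, by simp⟩
    exact ⟨e, fun z => by simpa using hep z, fun z x hx => he z _ (by simpa using hm x hx)⟩
  have hopt := G.optTour_le_of_walk p (finalLeaders H P) e fun z _ => hep z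
  set a := P.α / P.β
  set W := G.walkLength p
  set M := max 1 (Real.logb 2 G.diam)
  set R := G.tourRatio P.home (finalLeaders H P) t
  set S := ∑ x ∈ P.txs, G.dist x (m x)
  -- `B * A` bounds both the moves and the weighted detours of one kept level; the `+ 1` covers the
  -- sum `S` in the detours.
  set B := 16 * σ ^ 2 * (4 * I + 1) + 1 with hB
  have haW : 0 ≤ a * W := by positivity
  have hA0 : 0 ≤ A := by linarith
  have hB0 : 0 ≤ B := by positivity
  have hAM : A ≤ M * A := le_mul_of_one_le_left hA0 hM1
  have hsumM : ((keptLevels H P).card : ℝ) * (B * A) ≤ 3 * B * (M * A) := by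
    calc _ ≤ 3 * M * (B * A) := by gcongr; linarith
      _ = _ := by ring
  have htour : a * G.optTour P.home (finalLeaders H P) ≤ (2 + 3 * B) * (M * A) := by
    have hle : ∑ z ∈ finalLeaders H P, G.dist z (e z) ≤
        ∑ l ∈ keptLevels H P, ∑ z ∈ superLeadersAt H P l, G.dist z (e z) :=
      sum_biUnion_le fun z => G.dist_nonneg z (e z)
    have hle2 : 2 * a * ∑ l ∈ keptLevels H P, ∑ z ∈ superLeadersAt H P l, G.dist z (e z) ≤
        (keptLevels H P).card * (B * A) := by
      rw [mul_sum, ← nsmul_eq_mul]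
      refine sum_le_card_nsmul _ _ _ fun l hl => ?_
      have h2 := sum_superLeaders_le H (by linarith) (hlev l hl) m e he
      have h3 := hone l hl
      rw [hB]
      linarith
    calc a * G.optTour P.home (finalLeaders H P)
        ≤ a * (2 * W + 2 * ∑ l ∈ keptLevels H P, ∑ z ∈ superLeadersAt H P l, G.dist z (e z)) := by
          gcongr
          linarith
      _ ≤ _ := by linarith
  have hmove : ∑ l ∈ keptLevels H P, ∑ x ∈ assignedAt H P l, G.dist x (superLeader H l x) ≤
      3 * B * (M * A) := by
    refine le_trans ?_ hsumM
    rw [← nsmul_eq_mul]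
    refine sum_le_card_nsmul _ _ _ fun l hl => ?_
    refine (sum_le_card_nsmul _ _ _ fun x _ =>
      dist_superLeader_le H (by linarith) (hlev l hl) x).trans ?_
    rw [nsmul_eq_mul, hB]
    linarith [hone l hl]
  have hdir : ∑ x ∈ directTxs H P, G.dist x P.home ≤ (24 * I + 5) * (M * A) := by
    have h2 : ((directTxs H P).card : ℝ) * W ≤ (24 * I * M + 4) * A := by
      calc ((directTxs H P).card : ℝ) * W
          ≤ (3 * M * (8 * I * a) + 4 * a) * W := by
            gcongr
            refine hcard.trans ?_
            gcongr
        _ = (24 * I * M + 4) * (a * W) := by ring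
        _ ≤ _ := by gcongr; linarith
    linarith
  have hMA : M * A ≤ R * (M * A) := le_mul_of_one_le_left (by positivity) hR
  have hfin : (3 * B + (24 * I + 5)) * (M * A) ≤ (3 * B + (24 * I + 5)) * (R * (M * A)) := by
    gcongr
  have htourR := mul_le_mul_of_nonneg_left htour (by linarith : 0 ≤ R)
  -- The total coefficient is `(2 + 3 * B) + 3 * B + (24 * I + 5)`, from the tour, the moves to
  -- super-leaders and the direct moves.
  calc _ ≤ R * ((2 + 3 * B) * (M * A)) + (3 * B + (24 * I + 5)) * (M * A) := by linarith
    _ ≤ R * ((2 + 3 * B) * (M * A)) + (3 * B + (24 * I + 5)) * (R * (M * A)) := by linarith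
    _ = _ := by rw [hB]; ring

/-- Replacing each transaction's walk by a shortest path to its meeting point does not increase the
cost, so the schedule costs at least `β * A`. -/
theorem cost_le_of_schedule (h1 : ∀ a b : V, a ≠ b → 1 ≤ G.dist a b) (hD : 1 ≤ G.diam)
    {t : List V} (ht : IsTour P.home (finalLeaders H P) t) (s : Schedule G P) :
    cost H P t ≤ (24 * I + 13 + 96 * σ ^ 2 * (4 * I + 1)) *
      (s.cost * G.tourRatio P.home (finalLeaders H P) t * max 1 (Real.logb 2 G.diam)) := by
  let m : V → V := fun x => if h : x ∈ P.txs then s.meet ⟨x, h⟩ else P.home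
  have hm : ∀ x ∈ P.txs, m x ∈ s.objectWalk.support := fun x hx => by
    simpa [m, hx] using s.meet_mem ⟨x, hx⟩
  have hβ := P.β_pos
  have hsum : ∑ x ∈ P.txs, G.dist x (m x) ≤ ∑ x : P.txs, G.walkLength (s.txWalk x) := by
    rw [← sum_coe_sort]
    refine sum_le_sum fun x _ => ?_
    simp only [m, x.2, dif_pos]
    exact G.dist_le_walkLength (s.txWalk x)
  have hR : 0 ≤ G.tourRatio P.home (finalLeaders H P) t :=
    zero_le_one.trans (G.tourRatio_one_le ht)
  have hcost : P.β * (P.α / P.β * G.walkLength s.objectWalk + ∑ x ∈ P.txs, G.dist x (m x)) ≤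
      s.cost := by
    have h2 := mul_le_mul_of_nonneg_left hsum hβ.le
    rw [mul_add, ← mul_assoc, mul_div_cancel₀ _ hβ.ne', Schedule.cost]
    linarith
  have hmain := mul_le_mul_of_nonneg_left
    (cost_le_of_walk H h1 hD ht s.objectWalk m hm rfl) hβ.le
  calc cost H P t = P.β * (P.α / P.β * G.tourLength P.home t
        + ∑ l ∈ keptLevels H P, ∑ x ∈ assignedAt H P l, G.dist x (superLeader H l x)
        + ∑ x ∈ directTxs H P, G.dist x P.home) := by
        rw [cost]
        field_simp
    _ ≤ _ := hmain
    _ = (24 * I + 13 + 96 * σ ^ 2 * (4 * I + 1)) *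
        (P.β * (P.α / P.β * G.walkLength s.objectWalk + ∑ x ∈ P.txs, G.dist x (m x)) *
          G.tourRatio P.home (finalLeaders H P) t * max 1 (Real.logb 2 G.diam)) := by ring
    _ ≤ _ := by gcongr

theorem cost_le (h1 : ∀ a b : V, a ≠ b → 1 ≤ G.dist a b) {t : List V}
    (ht : IsTour P.home (finalLeaders H P) t) :
    cost H P t ≤ (24 * I + 13 + 96 * σ ^ 2 * (4 * I + 1)) * (optCost G P *
      G.tourRatio P.home (finalLeaders H P) t * max 1 (Real.logb 2 G.diam)) := by
  have hR : 0 ≤ G.tourRatio P.home (finalLeaders H P) t :=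
    zero_le_one.trans (G.tourRatio_one_le ht)
  have hM : 0 ≤ max 1 (Real.logb 2 G.diam) := zero_le_one.trans (le_max_left _ _)
  have := G.nonempty_schedule P
  -- If `D < 1`, the minimum distance leaves a single node and the algorithm costs nothing.
  -- Otherwise the bound for each schedule passes to the infimum.
  rcases le_or_gt 1 G.diam with hD | hD
  · rw [optCost, Real.iInf_mul_of_nonneg hR, Real.iInf_mul_of_nonneg hM,
      Real.mul_iInf_of_nonneg (by positivity)]
    exact le_ciInf fun s => cost_le_of_schedule H h1 hD ht s
  · have h0 : ∀ a b, G.dist a b = 0 := fun a b => by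
      rcases eq_or_ne a b with rfl | hab
      · exact G.dist_self a
      · exact absurd (h1 a b hab) (not_le.2 ((G.dist_le_diam a b).trans_lt hD))
    have hnil : t = [] := by
      by_contra hne
      cases t with
      | nil => exact hne rfl
      | cons x t =>
        have hx : x ∈ (finalLeaders H P).erase P.home := by rw [← ht.2]; simp
        have := h1 x P.home (ne_of_mem_erase hx)
        rw [h0] at this
        linarith
    have hc : cost H P t = 0 := by
      simp [cost, h0, hnil, WeightedGraph.tourLength, WeightedGraph.listLength]
    have hopt : 0 ≤ optCost G P := Real.iInf_nonneg fun s => by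
      have hα : 0 < P.α := P.β_pos.trans P.β_lt_α
      have hβ := P.β_pos
      exact add_nonneg (mul_nonneg hα.le (G.walkLength_nonneg _))
        (mul_nonneg hβ.le (sum_nonneg fun _ _ => G.walkLength_nonneg _))
    rw [hc]
    positivity

end GlobalAware

end DualFlow

theorem mainTheorem1 (δ : ℝ) :
    (∃ (σ : ℝ) (I : ℕ), ∀ (V : Type u) [Fintype V] [DecidableEq V]
      (G : DualFlow.WeightedGraph V),
      (∀ a b : V, a ≠ b → 1 ≤ G.dist a b) → G.doublingDim ≤ δ →
      Nonempty (DualFlow.PartitionHierarchy G σ I)) ∧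
    ∀ (σ : ℝ) (I : ℕ), ∃ K : ℝ, ∀ (V : Type u) [Fintype V] [DecidableEq V]
      (G : DualFlow.WeightedGraph V),
      (∀ a b : V, a ≠ b → 1 ≤ G.dist a b) → G.doublingDim ≤ δ →
      ∀ (H : DualFlow.PartitionHierarchy G σ I) (P : DualFlow.Problem V) (t : List V),
        DualFlow.IsTour P.home (DualFlow.GlobalAware.finalLeaders H P) t →
        DualFlow.GlobalAware.cost H P t ≤
          K * (DualFlow.optCost G P
            * G.tourRatio P.home (DualFlow.GlobalAware.finalLeaders H P) t
            * max 1 (Real.logb 2 G.diam)) :=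
  ⟨⟨2, ⌊(2 : ℝ) ^ (δ + 1)⌋₊ ^ 2, fun _ _ _ G _ hδ =>
      G.nonempty_partitionHierarchy fun v _ hr => G.exists_ball_cover hδ v hr⟩,
    fun σ I => ⟨24 * I + 13 + 96 * σ ^ 2 * (4 * I + 1), fun _ _ _ _ h1 _ H _ _ ht =>
      DualFlow.GlobalAware.cost_le H h1 ht⟩⟩
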